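/- Let $K$ be a field of characteristic different from $2$ and let $q:V\to K$ be a quadratic form, possibly degenerate, on a finite-dimensional $K$-vector space $V$. A quadratic form $q$ on $V$ is called *hyperbolic* if $V=U\oplus U'$ for some $K$-subspaces $U,U'\subseteq V$ on each of which $q$ vanishes, and *unimodular* if its associated symmetric bilinear form is nondegenerate. For an integer $n\ge 1$ let $n\times q$ denote the quadratic form $(v_1,\dots,v_n)\mapsto\sum_{i=1}^n q(v_i)$ on $V^n$. An ordering of $K$ is a subset $P\subseteq K^\times$ with $P+P\subseteq P$, $P\cdot P\subseteq P$ and $K^\times=P\sqcup -P$. For an ordering $P$, let $\mathrm{sgn}_P\,q$ be the largest dimension of a subspace of $V$ on which $q$ is positive definite relative to $P$, minus the largest dimension of a subspace on which $q$ is negative definite relative to $P$; and let $\mathrm{sgn}\,q$ be the function $P\mapsto \mathrm{sgn}_P\,q$ on the set of all orderings of $K$ (so $\mathrm{sgn}\,q=0$ holds automatically if $K$ has no orderings). Then: (i) $q$ is hyperbolic if and only if $q\cong q'\oplus\langle 0,\dots,0\rangle$ for some hyperbolic unimodular quadratic form $q'$ on a finite-dimensional $K$-vector space and some diagonal form $\langle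 0,\dots,0\rangle$ of dimension $m\ge 0$. (ii) There exists an integer $n\ge 1$ such that $n\times q$ is hyperbolic if and only if $\mathrm{sgn}\,q=0$; and in this case the smallest such $n$ is a power of $2$ (possibly $2^0=1$). -/

import Mathlib

universe u v

/-- An ordering `P` of a field `K`: a subset of `K \ {0}` closed under sums and products such that
`K \ {0}` is the disjoint union of `P` and `-P`. -/
structure FieldOrdering (K : Type u) [Field K] where
  /-- The set of positive elements. -/
  pos : Set K
  zero_notMem : (0 : K) ∉ pos
  add_mem : ∀ {a b : K}, a ∈ pos → b ∈ pos → a + b ∈ pos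
  mul_mem : ∀ {a b : K}, a ∈ pos → b ∈ pos → a * b ∈ pos
  mem_or_neg_mem : ∀ {a : K}, a ≠ 0 → a ∈ pos ∨ -a ∈ pos
  neg_notMem : ∀ {a : K}, a ∈ pos → -a ∉ pos

/-- The linear order on `K` given by an ordering `P`: `a < b` means `b - a ∈ P`. -/
@[reducible]
noncomputable def FieldOrdering.toLinearOrder {K : Type u} [Field K] (P : FieldOrdering K) :
    LinearOrder K where
  le a b := a = b ∨ b - a ∈ P.pos
  lt a b := b - a ∈ P.pos
  le_refl a := Or.inl rfl
  le_trans a b c := by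
    rintro (rfl | h) (rfl | h')
    · exact Or.inl rfl
    · exact Or.inr h'
    · exact Or.inr h
    · exact Or.inr (by simpa using P.add_mem h' h)
  lt_iff_le_not_ge a b := by
    constructor
    · intro h
      refine ⟨Or.inr h, ?_⟩
      rintro (rfl | h')
      · exact P.zero_notMem (by simpa using h)
      · exact P.neg_notMem h (by simpa using h')
    · rintro ⟨rfl | h, h'⟩
      · exact absurd (Or.inl rfl) h'
      · exact h
  le_antisymm a b := by
    rintro (rfl | h) (h' | h')
    · rfl
    · rfl
    · exact h'.symm
    · exact absurd (by simpa using h') (P.neg_notMem h)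
  le_total a b := by
    by_cases hab : a = b
    · exact Or.inl (Or.inl hab)
    · rcases P.mem_or_neg_mem (sub_ne_zero.mpr (Ne.symm hab)) with h | h
      · exact Or.inl (Or.inr h)
      · exact Or.inr (Or.inr (by simpa using h))
  toDecidableLE := Classical.decRel _

namespace QuadraticForm

/-- The signature of `q` at the ordering `P`: the largest dimension of a subspace on which `q` is
positive definite minus the largest dimension of a subspace on which `q` is negative definite. -/
noncomputable def signatureAt {K : Type u} [Field K] {V : Type v} [AddCommGroup V] [Module K V]
    (P : FieldOrdering K) (q : QuadraticForm K V) : ℤ :=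
  letI : LinearOrder K := P.toLinearOrder
  (sigPos q : ℤ) - (sigNeg q : ℤ)

/-- The total signature of `q`, a function on the set of all orderings of `K`. -/
noncomputable def totalSignature {K : Type u} [Field K] {V : Type v} [AddCommGroup V] [Module K V]
    (q : QuadraticForm K V) : FieldOrdering K → ℤ :=
  fun P => signatureAt P q

/-- A (possibly degenerate) quadratic form is hyperbolic if the space is the direct sum of two
subspaces on each of which the form vanishes. -/
def IsHyperbolic {K : Type u} [Field K] {V : Type v} [AddCommGroup V] [Module K V]
    (q : QuadraticForm K V) : Prop :=
  ∃ U W : Submodule K V, IsCompl U W ∧ (∀ x ∈ U, q x = 0) ∧ (∀ x ∈ W, q x = 0)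

/-- A quadratic form is unimodular if the bilinear form
`(x, y) ↦ (q (x + y) - q x - q y) / 2` is nondegenerate. The factor `1 / 2` is omitted: it is a
unit in characteristic different from `2`, the only case in which this definition is used. -/
def IsUnimodular {K : Type u} [Field K] {V : Type v} [AddCommGroup V] [Module K V]
    (q : QuadraticForm K V) : Prop :=
  (QuadraticMap.polarBilin q).Nondegenerate

/-- The diagonal form `⟨0, …, 0⟩` of dimension `m`. -/
def zeroDiagonal (K : Type u) [Field K] (m : ℕ) : QuadraticForm K (Fin m → K) :=
  QuadraticMap.weightedSumSquares K (fun _ : Fin m => (0 : K))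

/-- The form `n × q` on `V ^ n`, given by `(v₁, …, vₙ) ↦ q v₁ + ⋯ + q vₙ`. -/
def nTimes {K : Type u} [Field K] {V : Type v} [AddCommGroup V] [Module K V]
    (n : ℕ) (q : QuadraticForm K V) : QuadraticForm K (Fin n → V) :=
  QuadraticMap.pi (fun _ : Fin n => q)

end QuadraticForm

/-! For possibly degenerate forms, hyperbolicity is best replaced by the existence of a subspace `L`
with `L = L^⊥` (metabolic). In characteristic not 2 the two notions agree
(`isMetabolic_iff_isHyperbolic`), and metabolic forms satisfy cancellation (`IsMetabolic.of_prod`).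
Splitting off the radical then gives (i), since the zero form is metabolic and cancels.

For (ii), diagonalize and drop zero entries. The Witt ring is realized as `ℤ[Kˣ]` modulo
`wittIdeal`, and `n × q` is hyperbolic iff `n` kills the class `x` of `q` (`exists_class`). The
heart is Pfister's principle `diagonalClass_mem_wittTorsionIdeal`: vanishing signatures force `2 ^ k
• x = 0`. Otherwise some multiple of the class that is not 2-primary torsion is a simultaneous
eigenvector, with eigenvalues `±1`, of all the entries. A prime above its annihilator, avoiding 2,
defines an ordering realizing these signs, so the form acts on it by its signature, which is 0: a
contradiction. The least `n` is the additive order of `x`, a divisor of `2 ^ k`. -/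

namespace QuadraticForm

open _root_.QuadraticMap

/-! ### Metabolic forms: comparison with hyperbolic forms, and cancellation. -/

section Metabolic

variable {K : Type*} [Field K] {V : Type*} [AddCommGroup V] [Module K V]
  {V' : Type*} [AddCommGroup V'] [Module K V']

/-- A possibly degenerate quadratic form is metabolic if it vanishes on a subspace that contains
its own orthogonal complement. -/
def IsMetabolic (q : QuadraticForm K V) : Prop :=
  ∃ L : Submodule K V, (∀ x ∈ L, q x = 0) ∧ ∀ x, (∀ y ∈ L, polar q x y = 0) → x ∈ L

theorem polar_eq_zero_of_isotropic {q : QuadraticForm K V} {L : Submodule K V}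
    (hL : ∀ x ∈ L, q x = 0) {x y : V} (hx : x ∈ L) (hy : y ∈ L) : polar q x y = 0 := by
  simp [polar, hL _ hx, hL _ hy, hL _ (L.add_mem hx hy)]

/-- When `q` is degenerate, `U` may be smaller than `U^⊥`. Since `U ≤ U^⊥` and `W` complements `U`,
one has `U^⊥ = U ⊕ (W ∩ U^⊥)`, and this space is still isotropic. -/
theorem IsHyperbolic.isMetabolic {q : QuadraticForm K V} (h : IsHyperbolic q) :
    IsMetabolic q := by
  obtain ⟨U, W, hUW, hU, hW⟩ := h
  refine ⟨U ⊔ (W ⊓ LinearMap.ker (U.subtype.dualMap ∘ₗ polarBilin q)), ?_, ?_⟩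
  · intro x hx
    obtain ⟨u, hu, w, ⟨hw, hw'⟩, rfl⟩ := Submodule.mem_sup.1 hx
    have h0 : polar q w u = 0 := by
      simpa using LinearMap.congr_fun hw' ⟨u, hu⟩
    rw [QuadraticMap.map_add q, hU u hu, hW w hw, polar_comm, h0]
    simp
  · intro x hx
    obtain ⟨u, hu, w, hw, rfl⟩ := Submodule.mem_sup.1 (hUW.sup_eq_top ▸ Submodule.mem_top (x := x))
    refine Submodule.mem_sup.2 ⟨u, hu, w, ⟨hw, ?_⟩, rfl⟩
    ext y
    have h0 := hx y (Submodule.mem_sup_left y.2)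
    rw [polar_add_left, polar_eq_zero_of_isotropic hU hu y.2, zero_add] at h0
    simpa using h0

/-- A complement `C` of `L` is sheared along `L`: if `f : C → L` satisfies `polar q (f c) d = -polar
q c d / 2`, then `q (c + f c) = 0`. Such an `f` exists because `L → Dual C` is surjective, being the
transpose of `C → Dual L`, whose kernel `C ∩ L^⊥` lies in `C ∩ L = 0`. -/
theorem IsMetabolic.isHyperbolic [FiniteDimensional K V] (h2 : (2 : K) ≠ 0)
    {q : QuadraticForm K V} (h : IsMetabolic q) : IsHyperbolic q := by
  obtain ⟨L, hL, hL'⟩ := h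
  obtain ⟨C, hC⟩ := L.exists_isCompl
  -- the polar form induces a surjection `L → Dual C`
  let β : L →ₗ[K] Module.Dual K C := C.subtype.dualMap ∘ₗ polarBilin q ∘ₗ L.subtype
  have hβ : Function.Surjective β := by
    have hinj : Function.Injective β.flip := by
      rw [injective_iff_map_eq_zero]
      intro c hc
      have hcL : (c : V) ∈ L := hL' c fun y hy => by
        rw [polar_comm]
        simpa [β] using LinearMap.congr_fun hc ⟨y, hy⟩
      have := hC.disjoint.le_bot ⟨hcL, c.2⟩
      simpa using this
    have := LinearMap.dualMap_surjective_of_injective hinj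
    have he : β = β.flip.dualMap ∘ₗ (Module.evalEquiv K L).toLinearMap := by
      ext; simp
    rw [he]
    exact this.comp (Module.evalEquiv K L).surjective
  obtain ⟨σ, hσ⟩ := β.exists_rightInverse_of_surjective (LinearMap.range_eq_top.2 hβ)
  let γ : C →ₗ[K] Module.Dual K C := (-(2⁻¹ : K)) • C.subtype.dualMap ∘ₗ polarBilin q ∘ₗ C.subtype
  let f : C →ₗ[K] V := L.subtype ∘ₗ σ ∘ₗ γ
  have hfL : ∀ c, f c ∈ L := fun c => (σ (γ c)).2
  have hf : ∀ c d : C, polar q (f c) d = -(2⁻¹ * polar q c d) := by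
    intro c d
    have := LinearMap.congr_fun (LinearMap.congr_fun hσ (γ c)) d
    simpa [β, γ, f] using this
  refine ⟨L, LinearMap.range (C.subtype + f), ?_, hL, ?_⟩
  · rw [isCompl_iff, Submodule.disjoint_def, codisjoint_iff, eq_top_iff]
    constructor
    · rintro _ hx ⟨c, rfl⟩
      have hc : (c : V) ∈ L := by
        have := L.sub_mem hx (hfL c)
        simpa using this
      have := hC.disjoint.le_bot ⟨hc, c.2⟩
      have hc0 : c = 0 := by simpa using this
      simp [hc0]
    · rintro x -
      obtain ⟨l, hl, c, hc, rfl⟩ :=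
        Submodule.mem_sup.1 (hC.sup_eq_top ▸ Submodule.mem_top (x := x))
      refine Submodule.mem_sup.2 ⟨l - f ⟨c, hc⟩, L.sub_mem hl (hfL _), _, ⟨⟨c, hc⟩, rfl⟩, ?_⟩
      simp
  · rintro _ ⟨c, rfl⟩
    have h1 : polar q c c = 2 * q c := by simp
    rw [LinearMap.add_apply, QuadraticMap.map_add q, polar_comm, Submodule.subtype_apply, hf,
      hL _ (hfL c), h1]
    field_simp
    ring

theorem isMetabolic_iff_isHyperbolic [FiniteDimensional K V] (h2 : (2 : K) ≠ 0)
    {q : QuadraticForm K V} : IsMetabolic q ↔ IsHyperbolic q :=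
  ⟨fun h => h.isHyperbolic h2, fun h => h.isMetabolic⟩

theorem isMetabolic_zero : IsMetabolic (0 : QuadraticForm K V) :=
  ⟨⊤, by simp, by simp⟩

theorem IsMetabolic.of_equivalent {q : QuadraticForm K V} {q' : QuadraticForm K V'}
    (e : Equivalent q q') (h : IsMetabolic q) : IsMetabolic q' := by
  obtain ⟨e⟩ := e
  obtain ⟨L, hL, hL'⟩ := h
  have hp : ∀ x y, polar q' (e x) (e y) = polar q x y := fun x y => by
    simp only [polar, ← _root_.map_add e, e.map_app]
  refine ⟨L.map (e.toLinearEquiv : V →ₗ[K] V'), ?_, ?_⟩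
  · rintro _ ⟨x, hx, rfl⟩
    exact (e.map_app x).trans (hL x hx)
  · intro x hx
    obtain ⟨x, rfl⟩ := e.toLinearEquiv.surjective x
    exact ⟨x, hL' x fun y hy => by
      rw [← hp]
      exact hx _ ⟨y, hy, rfl⟩, rfl⟩

theorem isMetabolic_congr {q : QuadraticForm K V} {q' : QuadraticForm K V'}
    (e : Equivalent q q') : IsMetabolic q ↔ IsMetabolic q' :=
  ⟨.of_equivalent e, .of_equivalent e.symm⟩

theorem IsMetabolic.prod {q : QuadraticForm K V} {q' : QuadraticForm K V'}
    (h : IsMetabolic q) (h' : IsMetabolic q') : IsMetabolic (QuadraticMap.prod q q') := by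
  obtain ⟨L, hL, hL₂⟩ := h
  obtain ⟨M, hM, hM₂⟩ := h'
  refine ⟨L.prod M, ?_, ?_⟩
  · rintro ⟨x, y⟩ ⟨hx, hy⟩
    simp [hL x hx, hM y hy]
  · rintro ⟨x, y⟩ hxy
    refine ⟨hL₂ x fun z hz => ?_, hM₂ y fun z hz => ?_⟩
    · simpa using hxy (z, 0) ⟨hz, M.zero_mem⟩
    · simpa using hxy (0, z) ⟨L.zero_mem, hz⟩

/-- A subspace containing the radical contains its double orthogonal complement. -/
theorem mem_of_forall_orthogonal [FiniteDimensional K V] (q : QuadraticForm K V)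
    {A : Submodule K V} (hA : LinearMap.ker (polarBilin q) ≤ A) {x : V}
    (hx : ∀ y, (∀ a ∈ A, polar q a y = 0) → polar q x y = 0) : x ∈ A := by
  -- In the dual space, the image of `A` equals its double annihilator. The radical hypothesis then
  -- allows passing back from `polarBilin q x` to `x`.
  have hmem : polarBilin q x ∈ A.map (polarBilin q) := by
    rw [← Subspace.dualCoannihilator_dualAnnihilator_eq (W := A.map (polarBilin q)),
      Submodule.mem_dualAnnihilator]
    intro y hy
    rw [Submodule.mem_dualCoannihilator] at hy
    exact hx y fun a ha => hy _ ⟨a, ha, rfl⟩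
  obtain ⟨a, ha, hax⟩ := hmem
  have : x - a ∈ A := hA (by rw [LinearMap.mem_ker, map_sub, hax, sub_self])
  simpa using A.add_mem this ha

/-- Lagrangian reduction: the image in `V` of `N ∩ (V × L)` is the required subspace. If `x` is
orthogonal to it, then `(x, 0)` is orthogonal to `N ∩ (V × L) = (N + 0 × L)^⊥`, hence lies in `N + 0
× L`. -/
theorem IsMetabolic.of_prod [FiniteDimensional K V] [FiniteDimensional K V']
    {q : QuadraticForm K V} {q' : QuadraticForm K V'}
    (h : IsMetabolic (QuadraticMap.prod q q')) (h' : IsMetabolic q') : IsMetabolic q := by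
  obtain ⟨N, hN, hN₂⟩ := h
  obtain ⟨L, hL, hL₂⟩ := h'
  refine ⟨(N ⊓ (⊤ : Submodule K V).prod L).map (LinearMap.fst K V V'), ?_, ?_⟩
  · rintro _ ⟨⟨x, l⟩, ⟨hx, -, hl⟩, rfl⟩
    simpa [hL l hl] using hN _ hx
  · intro x hx
    have hker : LinearMap.ker (polarBilin (QuadraticMap.prod q q')) ≤
        N ⊔ (⊥ : Submodule K V).prod L := by
      refine le_sup_of_le_left fun z hz => hN₂ z fun y _ => ?_
      simpa using LinearMap.congr_fun hz y
    have hmem : ((x, 0) : V × V') ∈ N ⊔ (⊥ : Submodule K V).prod L := by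
      refine mem_of_forall_orthogonal _ hker ?_
      rintro ⟨y, l⟩ hyl
      have hl : l ∈ L := hL₂ l fun z hz => by
        rw [polar_comm]
        simpa using hyl (0, z) (Submodule.mem_sup_right ⟨rfl, hz⟩)
      have hy : ((y, l) : V × V') ∈ N := hN₂ _ fun z hz => by
        rw [polar_comm]
        exact hyl z (Submodule.mem_sup_left hz)
      simpa using hx y ⟨(y, l), ⟨hy, trivial, hl⟩, rfl⟩
    obtain ⟨n, hn, ⟨z, l⟩, ⟨hz, hl⟩, hsum⟩ := Submodule.mem_sup.1 hmem
    obtain rfl : z = 0 := by simpa using hz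
    obtain rfl : n = (x, -l) := by
      rw [eq_sub_of_add_eq hsum]
      simp
    exact ⟨(x, -l), ⟨hn, trivial, L.neg_mem hl⟩, rfl⟩

theorem isMetabolic_prod_iff [FiniteDimensional K V] [FiniteDimensional K V']
    {q : QuadraticForm K V} {q' : QuadraticForm K V'} (h' : IsMetabolic q') :
    IsMetabolic (QuadraticMap.prod q q') ↔ IsMetabolic q :=
  ⟨fun h => h.of_prod h', fun h => h.prod h'⟩

end Metabolic

/-! ### Splitting off the radical. -/

theorem zeroDiagonal_eq_zero (K : Type u) [Field K] (m : ℕ) : zeroDiagonal K m = 0 := by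
  ext; simp [zeroDiagonal]

theorem isHyperbolic_iff_exists_unimodular {K : Type u} [Field K] (h2 : (2 : K) ≠ 0)
    {V : Type v} [AddCommGroup V] [Module K V] [FiniteDimensional K V] (q : QuadraticForm K V) :
    IsHyperbolic q ↔
      ∃ (V' : Type v) (_ : AddCommGroup V') (_ : Module K V') (_ : FiniteDimensional K V')
        (q' : QuadraticForm K V') (m : ℕ), IsUnimodular q' ∧ IsHyperbolic q' ∧
        Equivalent q (QuadraticMap.prod q' (zeroDiagonal K m)) := by
  have : Invertible (2 : K) := invertibleOfNonzero h2
  constructor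
  · intro h
    obtain ⟨C, hC⟩ := q.radical.exists_isCompl
    have hpolar : ∀ r ∈ q.radical, ∀ x, polar q x r = 0 := fun r hr x => by
      rw [polar_comm]
      exact LinearMap.congr_fun (radical_le_ker_polarBilin hr) x
    have he : Equivalent (QuadraticMap.prod (q.restrict C)
        (zeroDiagonal K (Module.finrank K q.radical))) q := by
      refine ⟨⟨(LinearEquiv.prodCongr (LinearEquiv.refl K C)
        (Module.finBasis K q.radical).equivFun.symm).trans
        (C.prodEquivOfIsCompl _ hC.symm), ?_⟩⟩
      rintro ⟨x, y⟩
      obtain ⟨y, rfl⟩ := (Module.finBasis K q.radical).equivFun.surjective y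
      simp only [AddHom.toFun_eq_coe, LinearMap.coe_toAddHom, LinearEquiv.coe_coe,
        LinearEquiv.trans_apply, LinearEquiv.prodCongr_apply, LinearEquiv.refl_apply,
        LinearEquiv.symm_apply_apply, Submodule.coe_prodEquivOfIsCompl', prod_apply,
        zeroDiagonal_eq_zero, zero_apply, restrict_apply, QuadraticMap.map_add q,
        hpolar _ y.2, y.2.1, add_zero]
    refine ⟨C, _, _, inferInstance, q.restrict C, _, ?_, ?_, he.symm⟩
    · rw [IsUnimodular, nondegenerate_polar_iff, nondegenerate_iff_radical_eq_bot, eq_bot_iff]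
      intro x hx
      have hx' : (x : V) ∈ q.radical := by
        rw [radical_eq_ker_polarBilin] at hx ⊢
        ext y
        obtain ⟨c, hc, r, hr, rfl⟩ :=
          Submodule.mem_sup.1 (hC.symm.sup_eq_top ▸ Submodule.mem_top (x := y))
        have h0 : polar q x c = 0 := LinearMap.congr_fun hx ⟨c, hc⟩
        simp [polar_add_right, h0, hpolar r hr]
      have := hC.disjoint.le_bot ⟨hx', x.2⟩
      simpa using this
    · rw [← isMetabolic_iff_isHyperbolic h2] at h ⊢
      refine ((isMetabolic_congr he).2 h).of_prod ?_
      rw [zeroDiagonal_eq_zero]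
      exact isMetabolic_zero
  · rintro ⟨V', _, _, _, q', m, -, h, e⟩
    rw [← isMetabolic_iff_isHyperbolic h2] at h ⊢
    rw [isMetabolic_congr e, zeroDiagonal_eq_zero]
    exact h.prod isMetabolic_zero

/-- The map negating one of the two summands is an isometry between `q` and `-q`. -/
theorem IsHyperbolic.equivalent_neg {K V : Type*} [Field K] [AddCommGroup V] [Module K V]
    {q : QuadraticForm K V} (h : IsHyperbolic q) : Equivalent q (-q) := by
  obtain ⟨U, W, hUW, hU, hW⟩ := h
  refine ⟨⟨(U.prodEquivOfIsCompl W hUW).symm.trans ((LinearEquiv.prodCongr (LinearEquiv.refl K U)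
    (LinearEquiv.neg K)).trans (U.prodEquivOfIsCompl W hUW)), fun x => ?_⟩⟩
  obtain ⟨⟨u, w⟩, rfl⟩ := (U.prodEquivOfIsCompl W hUW).surjective x
  simp [QuadraticMap.map_add q, hU _ u.2, hW _ w.2]

end QuadraticForm

namespace QuadraticForm

open _root_.QuadraticMap

/-! ### Diagonal forms as multisets of entries, up to Witt triviality. -/

section Diagonal

variable {K : Type*} [Field K]

/-- Two families with the same multiset of values differ by a reindexing. -/
theorem exists_equiv_of_map_univ_eq {ι κ α : Type*} [Fintype ι] [Fintype κ] {f : ι → α} {g : κ → α}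
    (h : (Finset.univ : Finset ι).val.map f = (Finset.univ : Finset κ).val.map g) :
    ∃ e : ι ≃ κ, ∀ i, g (e i) = f i := by
  classical
  have hcard : ∀ a, Nonempty ({i // f i = a} ≃ {j // g j = a}) := fun a => by
    rw [← Fintype.card_eq, Fintype.card_subtype, Fintype.card_subtype]
    have := congrArg (Multiset.count a) h
    simpa [Multiset.count_map, Finset.card_def, eq_comm (a := a)] using this
  refine ⟨(Equiv.sigmaFiberEquiv f).symm.trans
    ((Equiv.sigmaCongrRight fun a => (hcard a).some).trans (Equiv.sigmaFiberEquiv g)), fun i => ?_⟩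
  exact ((hcard (f i)).some ⟨i, rfl⟩).2

theorem equivalent_weightedSumSquares_of_map_univ_eq {ι κ : Type*} [Fintype ι] [Fintype κ]
    {w : ι → K} {w' : κ → K}
    (h : (Finset.univ : Finset ι).val.map w = (Finset.univ : Finset κ).val.map w') :
    Equivalent (weightedSumSquares K w) (weightedSumSquares K w') := by
  obtain ⟨e, he⟩ := exists_equiv_of_map_univ_eq h
  refine ⟨⟨LinearEquiv.funCongrLeft K K e.symm, fun x => ?_⟩⟩
  simp only [weightedSumSquares_apply]
  rw [← e.sum_comp]
  simp [he, LinearEquiv.funCongrLeft_apply, LinearMap.funLeft_apply]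

/-- The diagonal form with the given entries is metabolic, i.e. trivial in the Witt group. -/
def IsWittTrivial (s : Multiset K) : Prop :=
  ∃ (n : ℕ) (w : Fin n → K), (Finset.univ : Finset (Fin n)).val.map w = s ∧
    IsMetabolic (weightedSumSquares K w)

theorem exists_map_univ_eq {α : Type*} (s : Multiset α) :
    ∃ (n : ℕ) (w : Fin n → α), (Finset.univ : Finset (Fin n)).val.map w = s := by
  induction s using Quotient.inductionOn with
  | h l => exact ⟨l.length, l.get, by simp⟩

theorem isWittTrivial_map_univ {ι : Type*} [Fintype ι] {w : ι → K} :
    IsWittTrivial ((Finset.univ : Finset ι).val.map w) ↔ IsMetabolic (weightedSumSquares K w) := by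
  constructor
  · rintro ⟨n, w', hw, h⟩
    exact h.of_equivalent (equivalent_weightedSumSquares_of_map_univ_eq hw)
  · intro h
    obtain ⟨n, w', hw⟩ := exists_map_univ_eq ((Finset.univ : Finset ι).val.map w)
    exact ⟨n, w', hw, h.of_equivalent (equivalent_weightedSumSquares_of_map_univ_eq hw.symm)⟩

theorem map_univ_sumElim {ι κ α : Type*} [Fintype ι] [Fintype κ] (w : ι → α) (w' : κ → α) :
    (Finset.univ : Finset (ι ⊕ κ)).val.map (Sum.elim w w') =
      (Finset.univ : Finset ι).val.map w + (Finset.univ : Finset κ).val.map w' := by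
  rw [← Finset.univ_disjSum_univ, Finset.val_disjSum, Multiset.disjSum, Multiset.map_add,
    Multiset.map_map, Multiset.map_map]
  rfl

theorem equivalent_weightedSumSquares_sumElim {ι κ : Type*} [Fintype ι] [Fintype κ]
    (w : ι → K) (w' : κ → K) :
    Equivalent (weightedSumSquares K (Sum.elim w w'))
      (QuadraticMap.prod (weightedSumSquares K w) (weightedSumSquares K w')) :=
  ⟨⟨LinearEquiv.sumArrowLequivProdArrow ι κ K K, fun x => by
    simp [weightedSumSquares_apply, LinearEquiv.sumArrowLequivProdArrow]⟩⟩

theorem isWittTrivial_add_iff {s t : Multiset K} (ht : IsWittTrivial t) :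
    IsWittTrivial (s + t) ↔ IsWittTrivial s := by
  obtain ⟨m, w, rfl⟩ := exists_map_univ_eq s
  obtain ⟨n, w', rfl⟩ := exists_map_univ_eq t
  rw [← map_univ_sumElim, isWittTrivial_map_univ, isWittTrivial_map_univ,
    isMetabolic_congr (equivalent_weightedSumSquares_sumElim w w'),
    isMetabolic_prod_iff (isWittTrivial_map_univ.1 ht)]

theorem IsWittTrivial.add {s t : Multiset K} (hs : IsWittTrivial s) (ht : IsWittTrivial t) :
    IsWittTrivial (s + t) :=
  (isWittTrivial_add_iff ht).2 hs

theorem isWittTrivial_replicate_zero (n : ℕ) : IsWittTrivial (Multiset.replicate n (0 : K)) := by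
  have : Multiset.replicate n (0 : K) = (Finset.univ : Finset (Fin n)).val.map fun _ => 0 := by
    simp
  rw [this, isWittTrivial_map_univ]
  convert isMetabolic_zero (K := K) (V := Fin n → K)
  ext
  simp

theorem isWittTrivial_zero : IsWittTrivial (0 : Multiset K) := by
  simpa using isWittTrivial_replicate_zero (K := K) 0

/-- Zero entries form a metabolic summand, so they cancel; this reduces degenerate forms to
multisets of units. -/
theorem isWittTrivial_filter_ne_zero [DecidableEq K] (s : Multiset K) :
    IsWittTrivial (s.filter (· ≠ 0)) ↔ IsWittTrivial s := by
  conv_rhs => rw [← Multiset.filter_add_not (· ≠ 0) s]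
  refine (isWittTrivial_add_iff ?_).symm
  have : (s.filter fun a => ¬ a ≠ 0) =
      Multiset.replicate (s.filter fun a => ¬ a ≠ 0).card 0 :=
    Multiset.eq_replicate_card.2 fun b hb => by simpa using (Multiset.mem_filter.1 hb).2
  rw [this]
  exact isWittTrivial_replicate_zero _

theorem IsWittTrivial.map_mul {s : Multiset K} (hs : IsWittTrivial s) {c : K} (hc : c ≠ 0) :
    IsWittTrivial (s.map (c * ·)) := by
  obtain ⟨n, w, rfl, L, hL, hL'⟩ := hs
  have hsm : weightedSumSquares K (fun i => c * w i) = c • weightedSumSquares K w := by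
    ext x
    simp [weightedSumSquares_apply, Finset.mul_sum, mul_assoc]
  rw [Multiset.map_map]
  refine isWittTrivial_map_univ.2 ?_
  change IsMetabolic (weightedSumSquares K fun i => c * w i)
  rw [hsm]
  refine ⟨L, fun x hx => by simp [hL x hx], fun x hx => hL' x fun y hy => ?_⟩
  have := hx y hy
  rw [show ⇑(c • weightedSumSquares K w) = c • ⇑(weightedSumSquares K w) from rfl,
    polar_smul] at this
  simpa [hc] using this

theorem polar_weightedSumSquares {ι : Type*} [Fintype ι] (w : ι → K) (x y : ι → K) :
    polar (weightedSumSquares K w) x y = 2 * ∑ i, w i * (x i * y i) := by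
  simp only [polar, weightedSumSquares_apply, Finset.mul_sum, ← Finset.sum_sub_distrib,
    Pi.add_apply, smul_eq_mul]
  exact Finset.sum_congr rfl fun _ _ => by ring

/-- The isotropic line spanned by `(c, 1)` is its own orthogonal complement. -/
theorem isWittTrivial_pair_mul_sq (h2 : (2 : K) ≠ 0) {a : K} (ha : a ≠ 0) {c : K} (hc : c ≠ 0) :
    IsWittTrivial {a, -(a * c ^ 2)} := by
  have : ({a, -(a * c ^ 2)} : Multiset K) =
      (Finset.univ : Finset (Fin 2)).val.map ![a, -(a * c ^ 2)] := rfl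
  rw [this, isWittTrivial_map_univ]
  refine ⟨K ∙ ![c, 1], ?_, ?_⟩
  · intro x hx
    obtain ⟨t, rfl⟩ := Submodule.mem_span_singleton.1 hx
    simp [weightedSumSquares_apply, Fin.sum_univ_two]
    ring
  · intro x hx
    have := hx _ (Submodule.mem_span_singleton_self _)
    rw [polar_weightedSumSquares] at this
    simp [Fin.sum_univ_two, h2] at this
    have h0 : x 0 = c * x 1 := by
      have : a * c * (x 0 - c * x 1) = 0 := by linear_combination this
      simpa [ha, hc, sub_eq_zero] using this
    refine Submodule.mem_span_singleton.2 ⟨x 1, ?_⟩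
    ext i
    fin_cases i
    · simp [h0, mul_comm]
    · simp

theorem isWittTrivial_pair_neg (h2 : (2 : K) ≠ 0) {a : K} (ha : a ≠ 0) :
    IsWittTrivial {a, -a} := by
  simpa using isWittTrivial_pair_mul_sq h2 ha one_ne_zero

/-- The relation `⟨a, b⟩ ≅ ⟨a + b, ab(a + b)⟩`. -/
theorem isWittTrivial_witt_relation (h2 : (2 : K) ≠ 0) {a b : K} (ha : a ≠ 0) (hb : b ≠ 0)
    (hab : a + b ≠ 0) : IsWittTrivial {a, b, -(a + b), -(a * b * (a + b))} := by
  have : ({a, b, -(a + b), -(a * b * (a + b))} : Multiset K) =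
      (Finset.univ : Finset (Fin 4)).val.map ![a, b, -(a + b), -(a * b * (a + b))] := rfl
  rw [this, isWittTrivial_map_univ]
  -- In `⟨a, b⟩` the vectors `(1, 1)` and `(b, -a)` are orthogonal, with values `a + b` and `a * b *
  -- (a + b)`. The plane is the graph of the resulting isometry.
  have hmem₁ : ![(1 : K), 1, 1, 0] ∈ Submodule.span K {![(1 : K), 1, 1, 0], ![b, -a, 0, 1]} :=
    Submodule.subset_span (by simp)
  have hmem₂ : ![b, -a, 0, 1] ∈ Submodule.span K {![(1 : K), 1, 1, 0], ![b, -a, 0, 1]} :=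
    Submodule.subset_span (by simp)
  refine ⟨Submodule.span K {![1, 1, 1, 0], ![b, -a, 0, 1]}, ?_, ?_⟩
  · intro x hx
    obtain ⟨s, t, rfl⟩ := Submodule.mem_span_pair.1 hx
    simp [weightedSumSquares_apply, Fin.sum_univ_four]
    ring
  · intro x hx
    have e₁ := hx _ hmem₁
    have e₂ := hx _ hmem₂
    rw [polar_weightedSumSquares] at e₁ e₂
    simp [Fin.sum_univ_four, h2] at e₁ e₂
    have h₁ : x 0 - x 1 = (a + b) * x 3 := by
      have : a * b * (x 0 - x 1 - (a + b) * x 3) = 0 := by linear_combination e₂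
      simpa [ha, hb, sub_eq_zero] using this
    have h₂ : x 0 = x 2 + b * x 3 := by
      have : (a + b) * (x 0 - (x 2 + b * x 3)) = 0 := by linear_combination e₁ + b * h₁
      simpa [hab, sub_eq_zero] using this
    refine Submodule.mem_span_pair.2 ⟨x 2, x 3, ?_⟩
    ext i
    fin_cases i
    · simp; linear_combination -h₂
    · simp; linear_combination h₁ - h₂
    · simp
    · simp

theorem isWittTrivial_add_map_neg (h2 : (2 : K) ≠ 0) (s : Multiset K) (hs : (0 : K) ∉ s) :
    IsWittTrivial (s + s.map Neg.neg) := by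
  induction s using Multiset.induction with
  | empty => simpa using isWittTrivial_zero
  | cons a s ih =>
    rw [Multiset.mem_cons, not_or] at hs
    have := (ih hs.2).add (isWittTrivial_pair_neg h2 (Ne.symm hs.1))
    convert this using 1
    rw [Multiset.map_cons, ← Multiset.singleton_add, ← Multiset.singleton_add,
      show ({a, -a} : Multiset K) = {a} + {-a} from rfl]
    abel

theorem map_univ_prod_snd (n : ℕ) {ι α : Type*} [Fintype ι] (w : ι → α) :
    (Finset.univ : Finset (Fin n × ι)).val.map (fun p => w p.2) =
      n • (Finset.univ : Finset ι).val.map w := by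
  classical
  ext a
  rw [Multiset.count_nsmul, Multiset.count_map, Multiset.count_map]
  have : ((Finset.univ : Finset (Fin n × ι)).filter fun p => a = w p.2) =
      (Finset.univ : Finset (Fin n)) ×ˢ (Finset.univ : Finset ι).filter fun i => a = w i := by
    ext; simp
  have h := congrArg Finset.card this
  rw [Finset.card_product, Finset.card_univ, Fintype.card_fin] at h
  exact h

theorem equivalent_nTimes {V : Type*} [AddCommGroup V] [Module K V] (n : ℕ)
    {q : QuadraticForm K V} {ι : Type*} [Fintype ι] {w : ι → K}
    (h : Equivalent q (weightedSumSquares K w)) :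
    Equivalent (nTimes n q) (weightedSumSquares K fun p : Fin n × ι => w p.2) := by
  refine (Equivalent.pi fun _ : Fin n => h).trans
    ⟨⟨(LinearEquiv.curry K K (Fin n) ι).symm, fun x => ?_⟩⟩
  simp [weightedSumSquares_apply, Fintype.sum_prod_type, pi_apply]

theorem isHyperbolic_nTimes_iff (h2 : (2 : K) ≠ 0) {V : Type*} [AddCommGroup V] [Module K V]
    [FiniteDimensional K V] (n : ℕ)
    {q : QuadraticForm K V} {ι : Type*} [Fintype ι] {w : ι → K}
    (h : Equivalent q (weightedSumSquares K w)) :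
    IsHyperbolic (nTimes n q) ↔ IsWittTrivial (n • (Finset.univ : Finset ι).val.map w) := by
  rw [← isMetabolic_iff_isHyperbolic h2, isMetabolic_congr (equivalent_nTimes n h),
    ← map_univ_prod_snd, isWittTrivial_map_univ]

end Diagonal

end QuadraticForm

/-! ### Orderings and sign characters. -/

namespace FieldOrdering

variable {K : Type*} [Field K]

theorem one_mem (P : FieldOrdering K) : (1 : K) ∈ P.pos := by
  rcases P.mem_or_neg_mem (one_ne_zero (α := K)) with h | h
  · exact h
  · simpa using P.mul_mem h h

theorem isStrictOrderedRing (P : FieldOrdering K) :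
    letI := P.toLinearOrder; IsStrictOrderedRing K := by
  let := P.toLinearOrder
  have : IsOrderedAddMonoid K := ⟨fun a b h c => by
    rcases h with rfl | h
    · exact Or.inl rfl
    · exact Or.inr (by simpa using h), fun a b h c => by
    rcases h with rfl | h
    · exact Or.inl rfl
    · exact Or.inr (by simpa using h)⟩
  have : ZeroLEOneClass K := ⟨Or.inr (by simpa using P.one_mem)⟩
  refine IsStrictOrderedRing.of_mul_pos fun a b (ha : a - 0 ∈ P.pos) (hb : b - 0 ∈ P.pos) => ?_
  change a * b - 0 ∈ P.pos
  rw [sub_zero] at *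
  exact P.mul_mem ha hb

/-- The ordering of elements with trivial sign, for a sign character with values in a domain of
characteristic different from two that respects the defining relations of the Witt ring. -/
def ofSign {D : Type*} [CommRing D] [IsDomain D] (hD : (2 : D) ≠ 0) (χ : Kˣ →* D)
    (hsq : ∀ u, χ u * χ u = 1) (hneg : ∀ u, χ (-u) = -χ u)
    (hadd : ∀ u v w : Kˣ, (u + v : K) = w → χ u + χ v = χ w + χ (u * v * w)) :
    FieldOrdering K where
  pos := {a | ∃ u : Kˣ, (u : K) = a ∧ χ u = 1}
  zero_notMem := by
    rintro ⟨u, hu, -⟩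
    exact u.ne_zero hu
  add_mem := by
    rintro _ _ ⟨u, rfl, hu⟩ ⟨v, rfl, hv⟩
    have huv : (u + v : K) ≠ 0 := by
      intro h
      have : v = -u := Units.ext (by simpa using (neg_eq_of_add_eq_zero_right h).symm)
      rw [this, hneg, hu] at hv
      exact hD (by linear_combination -hv)
    refine ⟨Units.mk0 _ huv, rfl, ?_⟩
    -- With both signs equal to 1 and `w = u + v`, the relation becomes `2 = 2 * χ w`.
    have := hadd u v (Units.mk0 _ huv) rfl
    rw [map_mul, map_mul, hu, hv] at this
    exact mul_left_cancel₀ hD (by linear_combination -this)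
  mul_mem := by
    rintro _ _ ⟨u, rfl, hu⟩ ⟨v, rfl, hv⟩
    exact ⟨u * v, by simp, by simp [hu, hv]⟩
  mem_or_neg_mem := by
    intro a ha
    rcases mul_self_eq_one_iff.1 (hsq (Units.mk0 a ha)) with h | h
    · exact Or.inl ⟨_, rfl, h⟩
    · exact Or.inr ⟨-Units.mk0 a ha, by simp, by rw [hneg, h, neg_neg]⟩
  neg_notMem := by
    rintro _ ⟨u, rfl, hu⟩ ⟨v, hv, hv'⟩
    obtain rfl : v = -u := Units.ext (by simpa using hv)
    rw [hneg, hu] at hv'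
    exact hD (by linear_combination -hv')

end FieldOrdering

namespace QuadraticForm

open _root_.QuadraticMap

/-! ### The Witt ring as a quotient of `ℤ[Kˣ]`. -/

section WittIdeal

variable {K : Type*} [Field K]

/-- The entries of a diagonal form as elements of the base field. -/
def unitEntries : Multiset Kˣ →+ Multiset K :=
  Multiset.mapAddMonoidHom Units.val

theorem zero_notMem_unitEntries (s : Multiset Kˣ) : (0 : K) ∉ unitEntries s := by
  simp [unitEntries]

/-- The element of the integral group ring of `Kˣ` given by a nondegenerate diagonal form. -/
noncomputable def diagonalClass : Multiset Kˣ →+ MonoidAlgebra ℤ Kˣ :=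
  Multiset.sumAddMonoidHom.comp (Multiset.mapAddMonoidHom (MonoidAlgebra.of ℤ Kˣ))

theorem diagonalClass_cons (a : Kˣ) (s : Multiset Kˣ) :
    diagonalClass (a ::ₘ s) = MonoidAlgebra.of ℤ Kˣ a + diagonalClass s := by
  simp [diagonalClass]

theorem diagonalClass_singleton (a : Kˣ) : diagonalClass {a} = MonoidAlgebra.of ℤ Kˣ a := by
  simp [diagonalClass]

theorem diagonalClass_map_mul (a : Kˣ) (s : Multiset Kˣ) :
    diagonalClass (s.map (a * ·)) = MonoidAlgebra.of ℤ Kˣ a * diagonalClass s := by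
  induction s using Multiset.induction with
  | empty => simp
  | cons b s ih => rw [Multiset.map_cons, diagonalClass_cons, diagonalClass_cons, ih, map_mul,
      mul_add]

/-- The coefficient at `a` is the multiplicity of `a` in the multiset. -/
theorem diagonalClass_injective : Function.Injective (diagonalClass (K := K)) := by
  classical
  have hcount : ∀ (s : Multiset Kˣ) (a : Kˣ), (diagonalClass s).coeff a = s.count a := by
    intro s a
    induction s using Multiset.induction with
    | empty => simp
    | cons b s ih =>
      rw [diagonalClass_cons, MonoidAlgebra.coeff_add, Finsupp.add_apply, ih, Multiset.count_cons,
        MonoidAlgebra.of_apply, MonoidAlgebra.coeff_single, Finsupp.single_apply]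
      by_cases h : a = b
      · simp [h, add_comm]
      · simp [h, Ne.symm h]
  intro s t h
  ext a
  have := hcount s a
  rw [h, hcount] at this
  exact_mod_cast this.symm

/-- The additive subgroup of the group ring spanned by differences of Witt equivalent forms. -/
noncomputable def wittSubgroup (K : Type*) [Field K] : AddSubgroup (MonoidAlgebra ℤ Kˣ) where
  carrier := {x | ∃ s t : Multiset Kˣ, x = diagonalClass s - diagonalClass t ∧
    IsWittTrivial (unitEntries s + (unitEntries t).map Neg.neg)}
  zero_mem' := ⟨0, 0, by simp, by simpa using isWittTrivial_zero⟩
  add_mem' := by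
    rintro _ _ ⟨s, t, rfl, h⟩ ⟨s', t', rfl, h'⟩
    refine ⟨s + s', t + t', by simp only [map_add]; abel, ?_⟩
    convert h.add h' using 1
    simp only [map_add, Multiset.map_add]
    abel
  neg_mem' := by
    rintro _ ⟨s, t, rfl, h⟩
    refine ⟨t, s, by abel, ?_⟩
    convert h.map_mul (neg_ne_zero.2 one_ne_zero) using 1
    simp [Multiset.map_map, add_comm]

/-- The kernel of the canonical homomorphism from the integral group ring of `Kˣ` to the Witt
ring. -/
noncomputable def wittIdeal (K : Type*) [Field K] : Ideal (MonoidAlgebra ℤ Kˣ) where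
  __ := wittSubgroup K
  smul_mem' r x hx := by
    change r * x ∈ wittSubgroup K
    induction r using MonoidAlgebra.induction_on with
    | of a =>
      obtain ⟨s, t, rfl, h⟩ := hx
      refine ⟨s.map (a * ·), t.map (a * ·), ?_, ?_⟩
      · rw [diagonalClass_map_mul, diagonalClass_map_mul, mul_sub]
      · convert h.map_mul a.ne_zero using 1
        simp [unitEntries, Multiset.map_map]
    | add f g hf hg =>
      rw [add_mul]
      exact add_mem hf hg
    | smul n f hf =>
      rw [smul_mul_assoc]
      exact zsmul_mem hf n

/-- Membership in `wittIdeal` provides only some representation `s' - t'`; this shows independence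
of that choice. Injectivity of `diagonalClass` gives `s + t' = s' + t`, and the trivial forms `t ⊥
-t` and `t' ⊥ -t'` can be added or cancelled. -/
theorem sub_mem_wittIdeal_iff (h2 : (2 : K) ≠ 0) (s t : Multiset Kˣ) :
    diagonalClass s - diagonalClass t ∈ wittIdeal K ↔
      IsWittTrivial (unitEntries s + (unitEntries t).map Neg.neg) := by
  constructor
  · rintro ⟨s', t', he, h⟩
    have hst : s + t' = s' + t := diagonalClass_injective (by
      rw [map_add, map_add]
      exact sub_eq_sub_iff_add_eq_add.1 he)
    have hst' := congrArg unitEntries hst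
    rw [map_add, map_add] at hst'
    rw [← isWittTrivial_add_iff
      (isWittTrivial_add_map_neg h2 (unitEntries t') (zero_notMem_unitEntries t'))]
    convert h.add
      (isWittTrivial_add_map_neg h2 (unitEntries t) (zero_notMem_unitEntries t)) using 1
    calc _ = (unitEntries s + unitEntries t') + ((unitEntries t).map Neg.neg +
          (unitEntries t').map Neg.neg) := by ac_rfl
      _ = _ := by rw [hst']; ac_rfl
  · exact fun h => ⟨s, t, rfl, h⟩

theorem mem_wittIdeal_iff (h2 : (2 : K) ≠ 0) (s : Multiset Kˣ) :
    diagonalClass s ∈ wittIdeal K ↔ IsWittTrivial (unitEntries s) := by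
  simpa using sub_mem_wittIdeal_iff h2 s 0

/-- This and the next two relations are what `FieldOrdering.ofSign` requires of a character. -/
theorem of_mul_self_sub_one_mem (h2 : (2 : K) ≠ 0) (u : Kˣ) :
    MonoidAlgebra.of ℤ Kˣ u * MonoidAlgebra.of ℤ Kˣ u - 1 ∈ wittIdeal K := by
  have := (sub_mem_wittIdeal_iff h2 {1} {u * u}).2
    (by
      have := isWittTrivial_pair_mul_sq h2 one_ne_zero u.ne_zero
      simpa [unitEntries, pow_two] using this)
  rw [diagonalClass_singleton, diagonalClass_singleton, map_mul, map_one] at this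
  simpa using neg_mem this

theorem of_add_of_neg_mem (h2 : (2 : K) ≠ 0) (u : Kˣ) :
    MonoidAlgebra.of ℤ Kˣ u + MonoidAlgebra.of ℤ Kˣ (-u) ∈ wittIdeal K := by
  have := (mem_wittIdeal_iff h2 {u, -u}).2
    (by simpa [unitEntries] using isWittTrivial_pair_neg h2 u.ne_zero)
  rwa [Multiset.insert_eq_cons, diagonalClass_cons, diagonalClass_singleton] at this

theorem of_add_of_sub_mem (h2 : (2 : K) ≠ 0) {u v w : Kˣ} (h : (u + v : K) = w) :
    MonoidAlgebra.of ℤ Kˣ u + MonoidAlgebra.of ℤ Kˣ v -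
      (MonoidAlgebra.of ℤ Kˣ w + MonoidAlgebra.of ℤ Kˣ (u * v * w)) ∈ wittIdeal K := by
  have := (sub_mem_wittIdeal_iff h2 {u, v} {w, u * v * w}).2
    (by
      have := isWittTrivial_witt_relation h2 u.ne_zero v.ne_zero (h ▸ w.ne_zero)
      rw [h] at this
      simpa [unitEntries, Multiset.insert_eq_cons, Multiset.cons_swap (-(w : K))] using this)
  rwa [Multiset.insert_eq_cons, Multiset.insert_eq_cons, diagonalClass_cons, diagonalClass_cons,
    diagonalClass_singleton, diagonalClass_singleton] at this

/-! ### Two-primary torsion and the local-global principle. -/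

/-- The elements of the group ring that become `2`-primary torsion in the Witt ring. -/
noncomputable def wittTorsionIdeal (K : Type*) [Field K] : Ideal (MonoidAlgebra ℤ Kˣ) where
  carrier := {x | ∃ k : ℕ, 2 ^ k * x ∈ wittIdeal K}
  zero_mem' := ⟨0, by simp⟩
  add_mem' := by
    rintro x y ⟨k, hk⟩ ⟨l, hl⟩
    refine ⟨k + l, ?_⟩
    have := add_mem (Ideal.mul_mem_left _ (2 ^ l) hk) (Ideal.mul_mem_left _ (2 ^ k) hl)
    convert this using 1
    ring
  smul_mem' := by
    rintro r x ⟨k, hk⟩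
    refine ⟨k, ?_⟩
    rw [smul_eq_mul, mul_left_comm]
    exact Ideal.mul_mem_left _ r hk

theorem wittIdeal_le_wittTorsionIdeal : wittIdeal K ≤ wittTorsionIdeal K :=
  fun x hx => ⟨0, by simpa using hx⟩

theorem mem_wittTorsionIdeal_of_two_pow_mul {x : MonoidAlgebra ℤ Kˣ} {k : ℕ}
    (h : 2 ^ k * x ∈ wittTorsionIdeal K) : x ∈ wittTorsionIdeal K := by
  obtain ⟨l, hl⟩ := h
  exact ⟨l + k, by rwa [pow_add, mul_assoc]⟩

/-- Outside the `2`-primary torsion, finitely many elements can be given signs simultaneously. -/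
theorem exists_eigenvector (h2 : (2 : K) ≠ 0) (F : Multiset Kˣ) {y : MonoidAlgebra ℤ Kˣ}
    (hy : y ∉ wittTorsionIdeal K) :
    ∃ r, r * y ∉ wittTorsionIdeal K ∧ ∀ a ∈ F,
      (MonoidAlgebra.of ℤ Kˣ a - 1) * r ∈ wittTorsionIdeal K ∨
      (MonoidAlgebra.of ℤ Kˣ a + 1) * r ∈ wittTorsionIdeal K := by
  induction F using Multiset.induction with
  | empty => exact ⟨1, by simpa using hy, by simp⟩
  | cons a F ih =>
    obtain ⟨r, hr, hF⟩ := ih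
    have hsq : ∀ r, (MonoidAlgebra.of ℤ Kˣ a - 1) * ((MonoidAlgebra.of ℤ Kˣ a + 1) * r) ∈
        wittTorsionIdeal K := fun r => by
      have := Ideal.mul_mem_left _ r
        (wittIdeal_le_wittTorsionIdeal (of_mul_self_sub_one_mem h2 a))
      convert this using 1
      ring
    -- Modulo torsion `(a - 1) * (a + 1) = 0`, so either factor makes `r` an eigenvector of `a`. If
    -- both products killed `y`, so would their difference `2 * r`, hence `r` itself.
    by_cases h : (MonoidAlgebra.of ℤ Kˣ a + 1) * r * y ∈ wittTorsionIdeal K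
    · refine ⟨(MonoidAlgebra.of ℤ Kˣ a - 1) * r, fun h' => hr ?_, ?_⟩
      · refine mem_wittTorsionIdeal_of_two_pow_mul (k := 1) ?_
        convert sub_mem h h' using 1
        ring
      · intro b hb
        rcases Multiset.mem_cons.1 hb with rfl | hb
        · right
          rw [mul_left_comm]
          exact hsq r
        · rw [mul_left_comm, mul_left_comm (MonoidAlgebra.of ℤ Kˣ b + 1)]
          exact (hF b hb).imp (Ideal.mul_mem_left _ _) (Ideal.mul_mem_left _ _)
    · refine ⟨_, h, fun b hb => ?_⟩
      rcases Multiset.mem_cons.1 hb with rfl | hb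
      · exact Or.inl (hsq r)
      · rw [mul_left_comm, mul_left_comm (MonoidAlgebra.of ℤ Kˣ b + 1)]
        exact (hF b hb).imp (Ideal.mul_mem_left _ _) (Ideal.mul_mem_left _ _)

/-- The ordering attached to a prime ideal of the Witt ring that does not contain `2`. -/
noncomputable def orderingOfPrime (h2 : (2 : K) ≠ 0) (p : Ideal (MonoidAlgebra ℤ Kˣ)) [p.IsPrime]
    (hp : wittIdeal K ≤ p) (hp2 : (2 : MonoidAlgebra ℤ Kˣ) ∉ p) : FieldOrdering K :=
  FieldOrdering.ofSign (D := MonoidAlgebra ℤ Kˣ ⧸ p)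
    (fun h => hp2 (Ideal.Quotient.eq_zero_iff_mem.1 ((map_ofNat _ 2).trans h)))
    (((Ideal.Quotient.mk p : MonoidAlgebra ℤ Kˣ →+* _) : MonoidAlgebra ℤ Kˣ →* _).comp
      (MonoidAlgebra.of ℤ Kˣ))
    (fun u => by
      have := Ideal.Quotient.eq_zero_iff_mem.2 (hp (of_mul_self_sub_one_mem h2 u))
      rw [map_sub, map_mul, map_one, sub_eq_zero] at this
      exact this)
    (fun u => by
      have := Ideal.Quotient.eq_zero_iff_mem.2 (hp (of_add_of_neg_mem h2 u))
      rw [map_add] at this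
      exact (neg_eq_of_add_eq_zero_right this).symm)
    (fun u v w h => by
      have := Ideal.Quotient.eq_zero_iff_mem.2 (hp (of_add_of_sub_mem h2 h))
      rw [map_sub, map_add, map_add, sub_eq_zero] at this
      exact this)

theorem mem_orderingOfPrime_iff (h2 : (2 : K) ≠ 0) (p : Ideal (MonoidAlgebra ℤ Kˣ)) [p.IsPrime]
    (hp : wittIdeal K ≤ p) (hp2 : (2 : MonoidAlgebra ℤ Kˣ) ∉ p) (u : Kˣ) :
    (u : K) ∈ (orderingOfPrime h2 p hp hp2).pos ↔ MonoidAlgebra.of ℤ Kˣ u - 1 ∈ p := by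
  rw [← Ideal.Quotient.eq_zero_iff_mem, map_sub, map_one, sub_eq_zero]
  constructor
  · rintro ⟨v, hv, h⟩
    obtain rfl := Units.ext hv
    exact h
  · exact fun h => ⟨u, rfl, h⟩

open scoped Classical in
/-- Pfister's local-global principle for nondegenerate diagonal forms. -/
theorem diagonalClass_mem_wittTorsionIdeal (h2 : (2 : K) ≠ 0) (s : Multiset Kˣ)
    (hs : ∀ P : FieldOrdering K, s.countP (fun a : Kˣ => (a : K) ∈ P.pos) =
      s.countP (fun a : Kˣ => -(a : K) ∈ P.pos)) :
    diagonalClass s ∈ wittTorsionIdeal K := by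
  by_contra hcon
  obtain ⟨r, hr, hF⟩ := exists_eigenvector h2 s hcon
  -- The annihilator of `r` modulo torsion. It contains no power of 2, since otherwise `r` would be
  -- torsion.
  let Q : Ideal (MonoidAlgebra ℤ Kˣ) :=
    Submodule.comap (LinearMap.toSpanSingleton (MonoidAlgebra ℤ Kˣ) _ r) (wittTorsionIdeal K)
  have hQ : ∀ x, x ∈ Q ↔ x * r ∈ wittTorsionIdeal K := fun x => Iff.rfl
  have hdisj : Disjoint (Q : Set (MonoidAlgebra ℤ Kˣ))
      (Submonoid.powers (2 : MonoidAlgebra ℤ Kˣ)) := by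
    rw [Set.disjoint_left]
    rintro _ hx ⟨k, rfl⟩
    refine hr (Ideal.mul_mem_right _ _ (mem_wittTorsionIdeal_of_two_pow_mul (k := k) ?_))
    exact (hQ _).1 hx
  obtain ⟨p, hp, hQp, hp2⟩ := Ideal.exists_le_prime_disjoint Q _ hdisj
  have hWp : wittIdeal K ≤ p := fun x hx =>
    hQp ((hQ x).2 (Ideal.mul_mem_right _ _ (wittIdeal_le_wittTorsionIdeal hx)))
  have h2p : (2 : MonoidAlgebra ℤ Kˣ) ∉ p := fun h =>
    Set.disjoint_left.1 hp2 h ⟨1, pow_one 2⟩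
  let P := orderingOfPrime h2 p hWp h2p
  have hP : ∀ u : Kˣ, (u : K) ∈ P.pos ↔ MonoidAlgebra.of ℤ Kˣ u - 1 ∈ p :=
    mem_orderingOfPrime_iff h2 p hWp h2p
  -- Each entry acts on `r` by its sign: `a - 1 ∈ Q ≤ p` makes `a` positive, while `a + 1 ∈ Q ≤ p`
  -- makes it negative. Hence a subform acts on `r` as its signature at `P`.
  have hkey : ∀ t ≤ s, (diagonalClass t - ((t.countP (fun a : Kˣ => (a : K) ∈ P.pos) : ℕ) -
      (t.countP (fun a : Kˣ => -(a : K) ∈ P.pos) : ℕ))) * r ∈ wittTorsionIdeal K := by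
    intro t
    induction t using Multiset.induction with
    | empty => simp
    | cons a t ih =>
      intro ht
      have ih := ih ((Multiset.le_cons_self t a).trans ht)
      have ha : a ∈ s := Multiset.mem_of_le ht (Multiset.mem_cons_self a t)
      rw [diagonalClass_cons, Multiset.countP_cons, Multiset.countP_cons]
      rcases hF a ha with h | h
      · have hpos : (a : K) ∈ P.pos := (hP a).2 (hQp h)
        rw [if_pos hpos, if_neg (P.neg_notMem hpos)]
        convert add_mem h ih using 1
        push_cast
        ring
      · have hpos : -(a : K) ∈ P.pos := by
          rw [← Units.val_neg, hP]
          have hap : MonoidAlgebra.of ℤ Kˣ a + 1 ∈ p := hQp h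
          convert sub_mem (hWp (of_add_of_neg_mem h2 a)) hap using 1
          ring
        rw [if_pos hpos, if_neg fun h' => P.neg_notMem h' hpos]
        convert add_mem h ih using 1
        push_cast
        ring
  have := hkey s le_rfl
  rw [hs P, sub_self, sub_zero, mul_comm] at this
  exact hr this

end WittIdeal

/-! ### Signatures and the Witt class of a form. -/

section Signature

variable {K : Type*} [Field K] {V : Type*} [AddCommGroup V] [Module K V]

open scoped Classical in
theorem signatureAt_of_equivalent (P : FieldOrdering K) {q : QuadraticForm K V} {ι : Type*}
    [Fintype ι] {w : ι → K} (h : Equivalent q (weightedSumSquares K w)) :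
    signatureAt P q = (((Finset.univ : Finset ι).val.map w).countP (· ∈ P.pos) : ℤ) -
      ((Finset.univ : Finset ι).val.map w).countP (-· ∈ P.pos) := by
  let := P.toLinearOrder
  have := P.isStrictOrderedRing
  rw [signatureAt, sigPos_of_equiv_weightedSumSquares h, sigNeg_of_equiv_weightedSumSquares h]
  have hlt : ∀ a b : K, a < b ↔ b - a ∈ P.pos := fun _ _ => Iff.rfl
  congr 2
  · rw [Multiset.countP_map, Set.ncard_eq_toFinset_card']
    simp [hlt, Finset.card_def]
  · rw [Multiset.countP_map, Set.ncard_eq_toFinset_card']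
    simp [hlt, Finset.card_def]

theorem signatureAt_nTimes (h2 : (2 : K) ≠ 0) [FiniteDimensional K V] (P : FieldOrdering K)
    (n : ℕ) (q : QuadraticForm K V) : signatureAt P (nTimes n q) = n * signatureAt P q := by
  classical
  have : Invertible (2 : K) := invertibleOfNonzero h2
  obtain ⟨w, hw⟩ := equivalent_weightedSumSquares q
  rw [signatureAt_of_equivalent P hw, signatureAt_of_equivalent P (equivalent_nTimes n hw),
    map_univ_prod_snd, Multiset.countP_nsmul, Multiset.countP_nsmul]
  push_cast
  ring

/-- An isometry `q ≅ -q` exchanges the positive and negative indices. -/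
theorem IsHyperbolic.signatureAt_eq_zero {q : QuadraticForm K V} (h : IsHyperbolic q)
    (P : FieldOrdering K) : signatureAt P q = 0 := by
  let := P.toLinearOrder
  rw [signatureAt, h.equivalent_neg.sigPos_eq, sigPos_neg, sub_self]

/-- Hyperbolicity of multiples is governed by an element of the Witt group, and the latter has
`2`-primary torsion if the total signature vanishes. -/
theorem exists_class (h2 : (2 : K) ≠ 0) [FiniteDimensional K V] (q : QuadraticForm K V) :
    ∃ x : MonoidAlgebra ℤ Kˣ ⧸ wittIdeal K,
      (∀ n : ℕ, IsHyperbolic (nTimes n q) ↔ n • x = 0) ∧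
      (totalSignature q = 0 → ∃ k : ℕ, 2 ^ k • x = 0) := by
  classical
  have : Invertible (2 : K) := invertibleOfNonzero h2
  obtain ⟨w, hw⟩ := equivalent_weightedSumSquares q
  -- The nonzero entries lift to units. The discarded zeros affect neither Witt triviality nor the
  -- sign counts.
  obtain ⟨s, hs⟩ : ∃ s : Multiset Kˣ,
      s.map Units.val = ((Finset.univ : Finset _).val.map w).filter (· ≠ 0) := by
    refine CanLift.prf (β := Multiset Kˣ) _ fun a ha => ?_
    exact (Multiset.mem_filter.1 ha).2.isUnit
  have hnx : ∀ n : ℕ, n • Ideal.Quotient.mk (wittIdeal K) (diagonalClass s) = 0 ↔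
      diagonalClass (n • s) ∈ wittIdeal K := fun n => by
    rw [← Ideal.Quotient.eq_zero_iff_mem, map_nsmul, map_nsmul]
  refine ⟨Ideal.Quotient.mk _ (diagonalClass s), fun n => ?_, fun hsgn => ?_⟩
  · rw [hnx, isHyperbolic_nTimes_iff h2 n hw, mem_wittIdeal_iff h2, map_nsmul,
      ← isWittTrivial_filter_ne_zero, Multiset.filter_nsmul, ← hs]
    rfl
  · obtain ⟨k, hk⟩ := diagonalClass_mem_wittTorsionIdeal h2 s fun P => by
      have h := congrFun hsgn P
      rw [totalSignature, signatureAt_of_equivalent P hw, Pi.zero_apply, sub_eq_zero] at h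
      have h' : ∀ p : K → Prop, (∀ a, p a → a ≠ 0) →
          ((Finset.univ : Finset _).val.map w).countP p = s.countP fun a : Kˣ => p a := by
        intro p hp
        rw [show (s.countP fun a : Kˣ => p a) = (s.map Units.val).countP p by
          rw [Multiset.countP_map, Multiset.countP_eq_card_filter], hs, Multiset.countP_filter]
        exact Multiset.countP_congr rfl fun a _ => by simpa using hp a
      rw [h' _ fun a ha h0 => P.zero_notMem (h0 ▸ ha),
        h' _ fun a ha h0 => P.zero_notMem (by simpa [h0] using ha)] at h
      exact_mod_cast h
    refine ⟨k, ?_⟩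
    rw [hnx, map_nsmul, nsmul_eq_mul]
    exact_mod_cast hk

end Signature

end QuadraticForm

theorem proposition1p1 {K : Type u} [Field K] (hK : ringChar K ≠ 2)
    {V : Type v} [AddCommGroup V] [Module K V] [FiniteDimensional K V]
    (q : QuadraticForm K V) :
    (QuadraticForm.IsHyperbolic q ↔
      ∃ (V' : Type v) (_ : AddCommGroup V') (_ : Module K V') (_ : FiniteDimensional K V')
        (q' : QuadraticForm K V') (m : ℕ),
        QuadraticForm.IsUnimodular q' ∧ QuadraticForm.IsHyperbolic q' ∧
        QuadraticMap.Equivalent q (QuadraticMap.prod q' (QuadraticForm.zeroDiagonal K m))) ∧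
    ((∃ n : ℕ, 0 < n ∧ QuadraticForm.IsHyperbolic (QuadraticForm.nTimes n q)) ↔
      QuadraticForm.totalSignature q = 0) ∧
    (QuadraticForm.totalSignature q = 0 →
      ∃ k : ℕ, IsLeast {n : ℕ | 0 < n ∧ QuadraticForm.IsHyperbolic (QuadraticForm.nTimes n q)}
        (2 ^ k)) := by
  have h2 : (2 : K) ≠ 0 := Ring.two_ne_zero hK
  obtain ⟨x, hx, hx2⟩ := QuadraticForm.exists_class h2 q
  refine ⟨QuadraticForm.isHyperbolic_iff_exists_unimodular h2 q, ⟨?_, fun h => ?_⟩, fun h => ?_⟩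
  · rintro ⟨n, hn, h⟩
    ext P
    have := h.signatureAt_eq_zero P
    rw [QuadraticForm.signatureAt_nTimes h2, mul_eq_zero] at this
    exact this.resolve_left (by exact_mod_cast hn.ne')
  · obtain ⟨k, hk⟩ := hx2 h
    exact ⟨2 ^ k, by positivity, (hx _).2 hk⟩
  · obtain ⟨k, hk⟩ := hx2 h
    -- The exponent `k` need not be minimal; the additive order of `x` is the least admissible `n`,
    -- and it divides `2 ^ k`.
    obtain ⟨j, -, hj⟩ := (Nat.dvd_prime_pow Nat.prime_two).1 (addOrderOf_dvd_of_nsmul_eq_zero hk)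
    refine ⟨j, ⟨by positivity, (hx _).2 (hj ▸ addOrderOf_nsmul_eq_zero x)⟩, ?_⟩
    rintro n ⟨hn, hn'⟩
    rw [← hj]
    exact addOrderOf_le_of_nsmul_eq_zero hn ((hx n).1 hn')
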